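/- Let $G$ be a group. For a set $A$, let $G$ act on $A^G$ by $(gx)(h)=x(g^{-1}h)$; two elements of $A^G$ are asymptotic if they agree outside a finite subset of $G$. For $M\subset G$ and $s\in S^G$ with $S=A^{A^M}$, let $\sigma_s\colon A^G\to A^G$ be the map $\sigma_s(x)(g)=s(g)\big((g^{-1}x)|_M\big)$, and let $\Sigma(s)\subset S^G$ be the closure of the orbit $\{gs : g\in G\}$ in the prodiscrete topology. A map $\tau\colon A^G\to A^G$ is pre-injective if $\tau(x)=\tau(y)$ implies $x=y$ for all asymptotic $x,y$; it is post-surjective if for all $x,y\in A^G$ with $y$ asymptotic to $\tau(x)$ there is $z$ asymptotic to $x$ with $\tau(z)=y$. The map $\sigma_s$ is stably injective (resp. stably post-surjective) if $\sigma_p$ is injective (resp. post-surjective) for every $p\in\Sigma(s)$. For a vector space $V$ over a field, $\mathrm{LNUCA}_c(G,V)$ is the set of all maps $\sigma_s\colon V^G\to V^G$ where $M\subset G$ is finite, every $s(g)\colon V^M\to V$ is linear, and $s$ is constant outside some finite subset of $G$. The group $G$ is $L^1$-surjunctive (resp. finitely $L^1$-surjunctive) if for every finite-dimensional vector space $V$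 over any field (resp. every finite vector space $V$), every stably injective $\tau\in\mathrm{LNUCA}_c(G,V)$ is surjective. It is dual $L^1$-surjunctive (resp. finitely dual $L^1$-surjunctive) if for every finite-dimensional vector space $V$ over any field (resp. every finite vector space $V$), every stably post-surjective $\tau\in\mathrm{LNUCA}_c(G,V)$ is pre-injective. For a field $k$, let $D^1(k[G])$ be the ring with underlying additive group $k[G]\times (k[G])[G]$ and multiplication $$(\alpha_1,\beta_1)*(\alpha_2,\beta_2)=(\alpha_1\alpha_2,\ \alpha_1\beta_2+\beta_1\alpha_2+\beta_1\beta_2),$$ where $\alpha_1\alpha_2$ is the product in $k[G]$ and, for $\alpha\in k[G]$, $\beta,\gamma\in(k[G])[G]$ and $g,h\in G$, $$(\alpha\beta)(g)(h)=\sum_{t\in G}\alpha(t)\,\beta(gt)(t^{-1}h),\quad (\beta\alpha)(g)(h)=\sum_{t\in G}\beta(g)(t)\,\alpha(t^{-1}h),\quad (\beta\gamma)(g)(h)=\sum_{t\in G}\beta(g)(t)\,\gamma(gt)(t^{-1}h).$$ A ring $R$ is stably finite if for every $n\ge 1$ and all $A,B\in M_n(R)$, $AB=1$ implies $BA=1$.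 Theorem. For every infinite group $G$, the following are equivalent: (i) $G$ is $L^1$-surjunctive; (ii) $G$ is finitely $L^1$-surjunctive; (iii) for every field $k$, the ring $D^1(k[G])$ is stably finite; (iv) for every finite field $k$, the ring $D^1(k[G])$ is stably finite; (v) $G$ is dual $L^1$-surjunctive; (vi) $G$ is finitely dual $L^1$-surjunctive. -/

import Mathlib

/-! ## Configurations and non-uniform cellular automata (NUCA) -/

universe u v

namespace CellularAutomata

/-- The Bernoulli shift action of `G` on configurations: `(g x)(h) = x (g⁻¹ h)`. -/
def shift {G A : Type*} [Group G] (g : G) (x : G → A) : G → A :=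
  fun h => x (g⁻¹ * h)

/-- Two configurations are asymptotic if they agree outside some finite subset of `G`. -/
def Asymptotic {G A : Type*} (x y : G → A) : Prop :=
  ∃ E : Set G, E.Finite ∧ ∀ g, g ∉ E → x g = y g

/-- The NUCA `σ_s : A^G → A^G` with memory `M` and configuration of local defining maps
`s : G → A^(A^M)`, given by `σ_s(x)(g) = s(g) ((g⁻¹ x)|_M)`. -/
def nuca {G A : Type*} [Group G] (M : Set G) (s : G → (M → A) → A) : (G → A) → (G → A) :=
  fun x g => s g (fun m : M => shift g⁻¹ x m)

/-- `Σ(s)`: the closure of the orbit of `s` under the shift, in the prodiscrete topology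
(the product of the discrete topologies). -/
def orbitClosure {G S : Type*} [Group G] (s : G → S) : Set (G → S) :=
  letI : TopologicalSpace S := ⊥
  closure (Set.range fun g : G => shift g s)

/-- A self-map of `A^G` is pre-injective if it is injective on pairs of asymptotic
configurations. -/
def PreInjective {G A : Type*} (τ : (G → A) → (G → A)) : Prop :=
  ∀ x y : G → A, Asymptotic x y → τ x = τ y → x = y

/-- A self-map of `A^G` is post-surjective if for all `x`, `y` with `y` asymptotic to `τ x`,
there is `z` asymptotic to `x` with `τ z = y`. -/
def PostSurjective {G A : Type*} (τ : (G → A) → (G → A)) : Prop :=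
  ∀ x y : G → A, Asymptotic y (τ x) → ∃ z : G → A, Asymptotic z x ∧ τ z = y

/-- `σ_s` is stably injective if `σ_p` is injective for all `p ∈ Σ(s)`. -/
def StablyInjective {G A : Type*} [Group G] (M : Set G) (s : G → (M → A) → A) : Prop :=
  ∀ p ∈ orbitClosure s, Function.Injective (nuca M p)

/-- `σ_s` is stably post-surjective if `σ_p` is post-surjective for all `p ∈ Σ(s)`. -/
def StablyPostSurjective {G A : Type*} [Group G] (M : Set G) (s : G → (M → A) → A) : Prop :=
  ∀ p ∈ orbitClosure s, PostSurjective (nuca M p)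

/-- `σ_s` belongs to `LNUCA_c(G, V)`, as witnessed by the memory `M` and the configuration of
local defining maps `s`: the memory is finite, every local defining map is `k`-linear, and
`s` is constant outside some finite subset of `G`. -/
structure IsLNUCAc (k : Type*) {G V : Type*} [Group G] [Field k] [AddCommGroup V] [Module k V]
    (M : Set G) (s : G → (M → V) → V) : Prop where
  finite_memory : M.Finite
  linear : ∀ g, IsLinearMap k (s g)
  asymptotically_constant : ∃ E : Set G, E.Finite ∧ ∀ g h, g ∉ E → h ∉ E → s g = s h


/-- `G` is `L¹`-surjunctive: for every finite-dimensional vector space `V` over any field, every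
stably injective element of `LNUCA_c(G, V)` is surjective. -/
def L1Surjunctive (G : Type u) [Group G] : Prop :=
  ∀ (k V : Type v) [Field k] [AddCommGroup V] [Module k V] [FiniteDimensional k V]
    (M : Set G) (s : G → (M → V) → V),
    IsLNUCAc k M s → StablyInjective M s → Function.Surjective (nuca M s)

/-- `G` is finitely `L¹`-surjunctive: for every finite vector space `V`, every stably injective
element of `LNUCA_c(G, V)` is surjective. -/
def FinitelyL1Surjunctive (G : Type u) [Group G] : Prop :=
  ∀ (k V : Type v) [Field k] [AddCommGroup V] [Module k V] [Finite V]
    (M : Set G) (s : G → (M → V) → V),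
    IsLNUCAc k M s → StablyInjective M s → Function.Surjective (nuca M s)

/-- `G` is dual `L¹`-surjunctive: for every finite-dimensional vector space `V` over any field,
every stably post-surjective element of `LNUCA_c(G, V)` is pre-injective. -/
def DualL1Surjunctive (G : Type u) [Group G] : Prop :=
  ∀ (k V : Type v) [Field k] [AddCommGroup V] [Module k V] [FiniteDimensional k V]
    (M : Set G) (s : G → (M → V) → V),
    IsLNUCAc k M s → StablyPostSurjective M s → PreInjective (nuca M s)

/-- `G` is finitely dual `L¹`-surjunctive: for every finite vector space `V`, every stably
post-surjective element of `LNUCA_c(G, V)` is pre-injective. -/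
def FinitelyDualL1Surjunctive (G : Type u) [Group G] : Prop :=
  ∀ (k V : Type v) [Field k] [AddCommGroup V] [Module k V] [Finite V]
    (M : Set G) (s : G → (M → V) → V),
    IsLNUCAc k M s → StablyPostSurjective M s → PreInjective (nuca M s)

end CellularAutomata

/-! ## The twisted group ring `D¹(k[G])` -/

/-- The underlying set `k[G] × (k[G])[G]` of `D¹(k[G])`: pairs of a regular part `reg` and a
singular part `sing`. It is not declared as a product so that it does not inherit the
component-wise multiplication. -/
@[ext]
structure D1 (k G : Type*) [Ring k] [Group G] where
  reg : MonoidAlgebra k G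
  sing : MonoidAlgebra (MonoidAlgebra k G) G

namespace D1

noncomputable section

variable {k G : Type*} [Ring k] [Group G]

/-- `D¹(k[G])` as a set is the product `k[G] × (k[G])[G]`. -/
def equivProd (k G : Type*) [Ring k] [Group G] :
    D1 k G ≃ MonoidAlgebra k G × MonoidAlgebra (MonoidAlgebra k G) G where
  toFun w := (w.reg, w.sing)
  invFun p := ⟨p.1, p.2⟩
  left_inv _ := rfl
  right_inv _ := rfl

/-- The addition is component-wise. -/
instance : AddCommGroup (D1 k G) := (equivProd k G).addCommGroup

theorem reg_add (w z : D1 k G) : (w + z).reg = w.reg + z.reg := rfl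
theorem sing_add (w z : D1 k G) : (w + z).sing = w.sing + z.sing := rfl
theorem reg_zero : (0 : D1 k G).reg = 0 := rfl
theorem sing_zero : (0 : D1 k G).sing = 0 := rfl

/-- `act b F g = ∑ₜ b(t) t · F(gt)`, an element of `k[G]`; its coefficient at `h` is
`∑ₜ b(t) F(gt)(t⁻¹h)`. -/
def act (b : MonoidAlgebra k G) (F : G → MonoidAlgebra k G) (g : G) : MonoidAlgebra k G :=
  b.coeff.sum fun t a => MonoidAlgebra.single t a * F (g * t)

theorem coeff_act (b : MonoidAlgebra k G) (F : G → MonoidAlgebra k G) (g h : G) :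
    (act b F g).coeff h = ∑ t ∈ b.coeff.support, b.coeff t * (F (g * t)).coeff (t⁻¹ * h) := by
  simp [act, Finsupp.sum, Finsupp.finsetSum_apply, MonoidAlgebra.coeff_single_mul_apply]

theorem act_support_finite (b : G → MonoidAlgebra k G) (c : MonoidAlgebra (MonoidAlgebra k G) G)
    (T : Finset G) (hT : ∀ g, (b g).coeff.support ⊆ T) :
    (Function.support fun g => act (b g) c.coeff g).Finite := by
  classical
  refine ((T ×ˢ c.coeff.support).image fun p => p.2 * p.1⁻¹).finite_toSet.subset ?_
  intro g hg
  by_contra hcon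
  refine hg (Finset.sum_eq_zero fun t ht => ?_)
  have : c.coeff (g * t) = 0 := by
    by_contra h0
    refine hcon ?_
    simp only [Finset.coe_image, Set.mem_image, Finset.mem_coe, Finset.mem_product]
    exact ⟨(t, g * t), ⟨hT g ht, Finsupp.mem_support_iff.2 h0⟩, by simp⟩
  simp [this]

/-- The twisted product `αβ` for `α ∈ k[G]`, `β ∈ (k[G])[G]`. -/
def regSing (α : MonoidAlgebra k G) (β : MonoidAlgebra (MonoidAlgebra k G) G) :
    MonoidAlgebra (MonoidAlgebra k G) G :=
  .ofCoeff (Finsupp.ofSupportFinite (fun g => act α β.coeff g)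
    (act_support_finite (fun _ => α) β α.coeff.support fun _ => subset_rfl))

/-- The twisted product `βα` for `α ∈ k[G]`, `β ∈ (k[G])[G]`. -/
def singReg (β : MonoidAlgebra (MonoidAlgebra k G) G) (α : MonoidAlgebra k G) :
    MonoidAlgebra (MonoidAlgebra k G) G :=
  .ofCoeff (β.coeff.mapRange (fun b => b * α) (zero_mul α))

open Classical in
/-- The twisted product `βγ` for `β, γ ∈ (k[G])[G]`. -/
def singSing (β γ : MonoidAlgebra (MonoidAlgebra k G) G) :
    MonoidAlgebra (MonoidAlgebra k G) G :=
  .ofCoeff (Finsupp.ofSupportFinite (fun g => act (β.coeff g) γ.coeff g)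
    (act_support_finite (fun g => β.coeff g) γ
      (β.coeff.support.biUnion fun g => (β.coeff g).coeff.support) fun g => by
        by_cases h : β.coeff g = 0
        · simp [h]
        · exact Finset.subset_biUnion_of_mem (fun g => (β.coeff g).coeff.support)
            (Finsupp.mem_support_iff.2 h)))

/-- `(αβ)(g)(h) = ∑ₜ α(t) β(gt)(t⁻¹h)`. -/
theorem coeff_regSing (α : MonoidAlgebra k G) (β : MonoidAlgebra (MonoidAlgebra k G) G)
    (g h : G) : ((regSing α β).coeff g).coeff h =
      ∑ t ∈ α.coeff.support, α.coeff t * (β.coeff (g * t)).coeff (t⁻¹ * h) :=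
  coeff_act _ _ _ _

/-- `(βα)(g)(h) = ∑ₜ β(g)(t) α(t⁻¹h)`. -/
theorem coeff_singReg (β : MonoidAlgebra (MonoidAlgebra k G) G) (α : MonoidAlgebra k G)
    (g h : G) : ((singReg β α).coeff g).coeff h =
      ∑ t ∈ (β.coeff g).coeff.support, (β.coeff g).coeff t * α.coeff (t⁻¹ * h) := by
  simp [singReg, MonoidAlgebra.coeff_mul_apply_left, Finsupp.sum]

/-- `(βγ)(g)(h) = ∑ₜ β(g)(t) γ(gt)(t⁻¹h)`. -/
theorem coeff_singSing (β γ : MonoidAlgebra (MonoidAlgebra k G) G)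
    (g h : G) : ((singSing β γ).coeff g).coeff h =
      ∑ t ∈ (β.coeff g).coeff.support,
        (β.coeff g).coeff t * (γ.coeff (g * t)).coeff (t⁻¹ * h) :=
  coeff_act _ _ _ _

/-- `(α₁, β₁) * (α₂, β₂) = (α₁α₂, α₁β₂ + β₁α₂ + β₁β₂)`. -/
instance : Mul (D1 k G) where
  mul w z := ⟨w.reg * z.reg,
    regSing w.reg z.sing + singReg w.sing z.reg + singSing w.sing z.sing⟩

instance : One (D1 k G) where
  one := ⟨1, 0⟩

theorem reg_mul (w z : D1 k G) : (w * z).reg = w.reg * z.reg := rfl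
theorem sing_mul (w z : D1 k G) : (w * z).sing =
    regSing w.reg z.sing + singReg w.sing z.reg + singSing w.sing z.sing := rfl
theorem reg_one : (1 : D1 k G).reg = 1 := rfl
theorem sing_one : (1 : D1 k G).sing = 0 := rfl

/-- The map `g ↦ α + β(g)` attached to `(α, β)`. -/
def ev (w : D1 k G) (g : G) : MonoidAlgebra k G := w.reg + w.sing.coeff g

theorem ext_ev {w z : D1 k G} (h : w.reg = z.reg) (h' : ∀ g, ev w g = ev z g) : w = z := by
  refine D1.ext h (MonoidAlgebra.coeff_injective (Finsupp.ext fun g => ?_))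
  have := h' g
  simpa [ev, h] using this

theorem act_zero_left (F : G → MonoidAlgebra k G) (g : G) : act 0 F g = 0 := by
  simp [act]

theorem act_single (t : G) (a : k) (F : G → MonoidAlgebra k G) (g : G) :
    act (MonoidAlgebra.single t a) F g = MonoidAlgebra.single t a * F (g * t) := by
  simp [act, Finsupp.sum_single_index]

theorem act_add_left (b c : MonoidAlgebra k G) (F : G → MonoidAlgebra k G) (g : G) :
    act (b + c) F g = act b F g + act c F g := by
  classical
  refine Finsupp.sum_add_index' ?_ ?_
  · simp
  · intro t a a'
    rw [MonoidAlgebra.single_add, add_mul]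

theorem act_add_right (b : MonoidAlgebra k G) (F F' : G → MonoidAlgebra k G) (g : G) :
    act b (fun x => F x + F' x) g = act b F g + act b F' g := by
  simp [act, Finsupp.sum, mul_add, Finset.sum_add_distrib]

theorem act_const (b c : MonoidAlgebra k G) (g : G) : act b (fun _ => c) g = b * c := by
  induction b using MonoidAlgebra.induction_linear with
  | zero => simp [act_zero_left]
  | add x y hx hy => rw [act_add_left, hx, hy, add_mul]
  | single t a => rw [act_single]

theorem act_single_mul (t : G) (a : k) (c : MonoidAlgebra k G) (F : G → MonoidAlgebra k G)
    (g : G) : act (MonoidAlgebra.single t a * c) F g =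
      MonoidAlgebra.single t a * act c F (g * t) := by
  induction c using MonoidAlgebra.induction_linear with
  | zero => simp [act_zero_left]
  | add x y hx hy => rw [mul_add, act_add_left, act_add_left, mul_add, hx, hy]
  | single q b =>
    rw [MonoidAlgebra.single_mul_single, act_single, act_single, ← mul_assoc (MonoidAlgebra.single t a),
      MonoidAlgebra.single_mul_single, mul_assoc]

theorem act_act (b : MonoidAlgebra k G) (F F' : G → MonoidAlgebra k G) (g : G) :
    act (act b F g) F' g = act b (fun x => act (F x) F' x) g := by
  induction b using MonoidAlgebra.induction_linear with
  | zero => simp [act_zero_left]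
  | add x y hx hy => rw [act_add_left, act_add_left, act_add_left, hx, hy]
  | single t a => rw [act_single, act_single, act_single_mul]

theorem ev_add (w z : D1 k G) (g : G) : ev (w + z) g = ev w g + ev z g := by
  simp only [ev, reg_add, sing_add, MonoidAlgebra.coeff_add, Finsupp.add_apply]
  abel

theorem ev_mul (w z : D1 k G) (g : G) : ev (w * z) g = act (ev w g) (ev z) g := by
  have h1 : (regSing w.reg z.sing).coeff g = act w.reg z.sing.coeff g := rfl
  have h2 : (singReg w.sing z.reg).coeff g = w.sing.coeff g * z.reg := rfl
  have h3 : (singSing w.sing z.sing).coeff g = act (w.sing.coeff g) z.sing.coeff g := rfl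
  have h4 : ev z = fun x => (fun _ => z.reg) x + z.sing.coeff x := rfl
  rw [h4, act_add_right, act_const, ev, ev, reg_mul, sing_mul, MonoidAlgebra.coeff_add,
    MonoidAlgebra.coeff_add, Finsupp.add_apply, Finsupp.add_apply, h1, h2, h3, act_add_left,
    add_mul]
  abel

theorem ev_one (g : G) : ev (1 : D1 k G) g = 1 := by
  simp [ev, reg_one, sing_one]

/-- `D¹(k[G])` is a ring with zero `(0, 0)` and unit `(1_G, 0)`. -/
instance : Ring (D1 k G) :=
  { (inferInstance : AddCommGroup (D1 k G)), (inferInstance : Mul (D1 k G)),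
    (inferInstance : One (D1 k G)) with
    mul_assoc := fun a b c => ext_ev (by simp only [reg_mul, mul_assoc]) fun g => by
      rw [ev_mul, ev_mul, act_act, ev_mul]
      congr 1
      funext x
      rw [ev_mul]
    one_mul := fun a => ext_ev (by simp only [reg_mul, reg_one, one_mul]) fun g => by
      rw [ev_mul, ev_one, MonoidAlgebra.one_def, act_single, mul_one, ← MonoidAlgebra.one_def,
        one_mul]
    mul_one := fun a => ext_ev (by simp only [reg_mul, reg_one, mul_one]) fun g => by
      have h : ev (1 : D1 k G) = fun _ => 1 := funext ev_one
      rw [ev_mul, h, act_const, mul_one]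
    left_distrib := fun a b c => ext_ev (by simp only [reg_mul, reg_add, mul_add]) fun g => by
      have h : ev (b + c) = fun x => ev b x + ev c x := funext (ev_add b c)
      rw [ev_mul, h, act_add_right, ev_add, ev_mul, ev_mul]
    right_distrib := fun a b c => ext_ev (by simp only [reg_mul, reg_add, add_mul]) fun g => by
      rw [ev_mul, ev_add, act_add_left, ev_add, ev_mul, ev_mul]
    zero_mul := fun a => ext_ev (by simp only [reg_mul, reg_zero, zero_mul]) fun g => by
      have h : ev (0 : D1 k G) g = 0 := by simp [ev, reg_zero, sing_zero]
      rw [ev_mul, h, act_zero_left]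
    mul_zero := fun a => ext_ev (by simp only [reg_mul, reg_zero, mul_zero]) fun g => by
      have h : ev (0 : D1 k G) = fun _ => 0 := by
        funext x
        simp [ev, reg_zero, sing_zero]
      rw [ev_mul, h, act_const, mul_zero] }

end

end D1

/-! ## Finitely generated rings over `ℤ` -/

/-! An element `w` of `D1 k G` is a function `ev w : G → k[G]` equal to `w.reg` off a finite set. It
acts on configurations by `(w x)(g) = ∑ₜ ev w g (t) x(gt)`, and the twisted product is composition
of operators. For infinite `G` this action is faithful, and in coordinates the maps in `LNUCA_c(G,
V)` are exactly the operators of square matrices `W` over `D1 k G` (`IsLNUCAc.exists_matrix`,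
`exists_isLNUCAc`). The orbit closure of `s` consists of the shifts of `s` and its constant value,
so the stable properties concern only `W` and its constant part.

If both of these act injectively, linear duality recovers each coordinate of `x` from finitely many
coordinates of `W x`. Translates of one recovery rule for the constant part work at all but finitely
many places, where individual rules replace them; the result is a left inverse over `D1 k G`
(`exists_left_inverse`). Dually, finitely supported preimages of delta configurations patch to a
right inverse (`exists_right_inverse`). Stable finiteness makes one-sided inverses two-sided, which
gives surjectivity and pre-injectivity respectively.

Conversely, a one-sided inverse makes `W` stably injective or stably post-surjective, because taking
constant parts is a ring homomorphism; surjectivity or pre-injectivity then allows cancellation.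
Finally, a failure of stable finiteness is defined over a finitely generated domain over `ℤ` and
survives in one of its finite residue fields. -/

theorem Int.isJacobsonRing : IsJacobsonRing ℤ := by
  refine isJacobsonRing_iff_prime_eq.2 fun P hP => ?_
  by_cases h : P = ⊥
  · subst h
    refine le_antisymm (fun x hx => ?_) Ideal.le_jacobson
    -- Membership in the radical makes `x * x + 1` a unit, hence `1` or `-1`, which forces `x = 0`.
    have hu := Ideal.mem_jacobson_bot.1 hx x
    rcases Int.isUnit_iff.1 hu with h1 | h1
    · simpa using h1
    · nlinarith [mul_self_nonneg x]
  · have := hP.isMaximal h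
    exact Ideal.jacobson_eq_self_of_isMaximal

/-- By the Nullstellensatz over a Jacobson ring, `L` is a finite `ℤ`-module. Characteristic zero
would make `ℤ` a field by integrality; otherwise `L` is killed by its characteristic, and a finitely
generated torsion `ℤ`-module is finite. -/
theorem Field.finite_of_finiteType_int (L : Type*) [Field L] [Algebra.FiniteType ℤ L] :
    Finite L := by
  have := Int.isJacobsonRing
  have : Module.Finite ℤ L := finite_of_finite_type_of_isJacobsonRing ℤ L
  obtain ⟨p, hp⟩ := CharP.exists L
  have hp0 : p ≠ 0 := by
    rintro rfl
    have := CharP.charP_to_charZero L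
    have hinj : Function.Injective (algebraMap ℤ L) := by
      intro a b hab
      simpa using hab
    have hf : IsField ℤ := isField_of_isIntegral_of_isField hinj (Field.toIsField L)
    obtain ⟨b, hb⟩ := hf.mul_inv_cancel (a := 2) (by norm_num)
    omega
  refine Module.finite_of_fg_torsion L fun {x} => ?_
  refine ⟨⟨(p : ℤ), mem_nonZeroDivisors_of_ne_zero (by exact_mod_cast hp0)⟩, ?_⟩
  have : ((p : ℤ) : L) = 0 := by simp
  rw [Submonoid.mk_smul, zsmul_eq_mul, this, zero_mul]

/-- An element of a finitely generated domain over `ℤ` that is nonzero stays nonzero in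
some finite residue field. -/
theorem exists_finite_residueField (A : Type v) [CommRing A] [IsDomain A] [Algebra.FiniteType ℤ A]
    (a : A) (ha : a ≠ 0) :
    ∃ (L : Type v) (_ : Field L) (_ : Finite L) (φ : A →+* L), φ a ≠ 0 := by
  have := Int.isJacobsonRing
  have : IsJacobsonRing A := isJacobsonRing_of_finiteType (A := ℤ)
  -- The zero ideal is an intersection of maximal ideals, so some maximal ideal misses `a`.
  have hj : (⊥ : Ideal A).jacobson = ⊥ := (isJacobsonRing_iff_prime_eq.1 ‹_›) ⊥ Ideal.isPrime_bot
  have h1 : a ∉ (⊥ : Ideal A).jacobson := by rwa [hj]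
  rw [Ideal.jacobson, Submodule.mem_sInf] at h1
  push Not at h1
  obtain ⟨m, ⟨-, hm⟩, ham⟩ := h1
  let : Field (A ⧸ m) := Ideal.Quotient.field m
  have : @Algebra.FiniteType ℤ (A ⧸ m) _ _ (Ring.toIntAlgebra _) :=
    Algebra.FiniteType.of_surjective (Ideal.Quotient.mk m).toIntAlgHom Ideal.Quotient.mk_surjective
  exact ⟨A ⧸ m, inferInstance, Field.finite_of_finiteType_int _, Ideal.Quotient.mk m,
    fun h => ham (Ideal.Quotient.eq_zero_iff_mem.1 h)⟩

/-! ## Functoriality of `D¹(k[G])` in the coefficient ring -/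

namespace D1

noncomputable section

variable {A B G : Type*} [Ring A] [Ring B] [Group G]

theorem map_act (φ : A →+* B) (b : MonoidAlgebra A G) (F : G → MonoidAlgebra A G) (g : G) :
    MonoidAlgebra.mapRingHom G φ (act b F g) =
      act (MonoidAlgebra.mapRingHom G φ b) (fun x => MonoidAlgebra.mapRingHom G φ (F x)) g := by
  induction b using MonoidAlgebra.induction_linear with
  | zero => simp [act_zero_left]
  | add x y hx hy => rw [act_add_left, map_add, hx, hy, map_add, act_add_left]
  | single t a => rw [act_single, map_mul, MonoidAlgebra.mapRingHom_single, act_single]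

/-- The map on `D¹` induced by a homomorphism of coefficient rings, as a function. -/
def mapFun (φ : A →+* B) (w : D1 A G) : D1 B G :=
  ⟨MonoidAlgebra.mapRingHom G φ w.reg,
    .ofCoeff (w.sing.coeff.mapRange (MonoidAlgebra.mapRingHom G φ) (map_zero _))⟩

theorem ev_mapFun (φ : A →+* B) (w : D1 A G) (g : G) :
    ev (mapFun φ w) g = MonoidAlgebra.mapRingHom G φ (ev w g) := by
  simp [ev, mapFun]

/-- The ring homomorphism of `D¹` induced by a homomorphism of coefficient rings. -/
def map (φ : A →+* B) : D1 A G →+* D1 B G where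
  toFun := mapFun φ
  map_one' := ext_ev (by simp [mapFun, reg_one]) fun g => by rw [ev_mapFun, ev_one, map_one, ev_one]
  map_mul' w z := ext_ev (by simp [mapFun, reg_mul]) fun g => by
    rw [ev_mapFun, ev_mul, ev_mul, map_act, ev_mapFun, funext (ev_mapFun φ z)]
  map_zero' := ext_ev (by simp [mapFun, reg_zero]) fun g => by
    rw [ev_mapFun]; simp [ev, reg_zero, sing_zero]
  map_add' w z := ext_ev (by simp [mapFun, reg_add]) fun g => by
    rw [ev_mapFun, ev_add, ev_add, map_add, ev_mapFun, ev_mapFun]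

theorem map_reg_coeff (φ : A →+* B) (w : D1 A G) (t : G) :
    (map φ w).reg.coeff t = φ (w.reg.coeff t) :=
  MonoidAlgebra.coeff_mapRingHom _ _ _

theorem map_sing_coeff (φ : A →+* B) (w : D1 A G) (g t : G) :
    ((map φ w).sing.coeff g).coeff t = φ ((w.sing.coeff g).coeff t) :=
  MonoidAlgebra.coeff_mapRingHom _ _ _

theorem ext_coeff {w z : D1 A G} (h : ∀ t, w.reg.coeff t = z.reg.coeff t)
    (h' : ∀ g t, (w.sing.coeff g).coeff t = (z.sing.coeff g).coeff t) : w = z :=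
  D1.ext (MonoidAlgebra.coeff_injective (Finsupp.ext h))
    (MonoidAlgebra.coeff_injective (Finsupp.ext fun g =>
      MonoidAlgebra.coeff_injective (Finsupp.ext (h' g))))

theorem map_injective {φ : A →+* B} (hφ : Function.Injective φ) :
    Function.Injective (map φ : D1 A G → D1 B G) := fun w z h =>
  ext_coeff (fun t => hφ (by rw [← map_reg_coeff, h, map_reg_coeff]))
    fun g t => hφ (by rw [← map_sing_coeff, h, map_sing_coeff])

/-- The set of all coefficients of an element of `D¹`. -/
def coeffs (w : D1 A G) : Set A :=
  Set.range w.reg.coeff ∪ ⋃ g, Set.range (w.sing.coeff g).coeff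

theorem finite_coeffs (w : D1 A G) : w.coeffs.Finite := by
  refine w.reg.coeff.finite_range.union ?_
  have : (⋃ g, Set.range (w.sing.coeff g).coeff) ⊆
      {0} ∪ ⋃ g ∈ w.sing.coeff.support, Set.range (w.sing.coeff g).coeff := by
    rintro a ha
    obtain ⟨g, t, rfl⟩ := Set.mem_iUnion.1 ha
    by_cases h : w.sing.coeff g = 0
    · left; simp [h]
    · right
      exact Set.mem_biUnion (Finsupp.mem_support_iff.2 h) ⟨t, rfl⟩
  exact ((Set.finite_singleton _).union
    (Set.Finite.biUnion (Finset.finite_toSet _) fun g _ => Finsupp.finite_range _)).subset this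

theorem exists_mapRingHom_eq {φ : A →+* B} (hφ : Function.Injective φ) (x : MonoidAlgebra B G)
    (h : ∀ t, x.coeff t ∈ Set.range φ) : ∃ y, MonoidAlgebra.mapRingHom G φ y = x := by
  choose f hf using h
  refine ⟨.ofCoeff (Finsupp.ofSupportFinite f (x.coeff.hasFiniteSupport.subset fun t ht h0 => ?_)),
    ?_⟩
  · exact ht (hφ (by rw [hf, h0, map_zero]))
  · refine MonoidAlgebra.coeff_injective (Finsupp.ext fun t => ?_)
    rw [MonoidAlgebra.coeff_mapRingHom]
    exact hf t

theorem exists_map_eq {φ : A →+* B} (hφ : Function.Injective φ) (w : D1 B G)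
    (h : w.coeffs ⊆ Set.range φ) : ∃ z, map φ z = w := by
  obtain ⟨r, hr⟩ := exists_mapRingHom_eq hφ w.reg fun t => h (Or.inl ⟨t, rfl⟩)
  have hs := fun g => exists_mapRingHom_eq hφ (w.sing.coeff g) fun t =>
    h (Or.inr (Set.mem_iUnion.2 ⟨g, t, rfl⟩))
  choose f hf using hs
  refine ⟨⟨r, .ofCoeff (Finsupp.ofSupportFinite f
    (w.sing.coeff.hasFiniteSupport.subset fun g hg h0 => hg ?_))⟩, ext_coeff (fun t => ?_)
    fun g t => ?_⟩
  · refine MonoidAlgebra.coeff_injective (Finsupp.ext fun t => hφ ?_)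
    rw [← MonoidAlgebra.coeff_mapRingHom, hf, h0]
    simp
  · rw [map_reg_coeff, ← hr, MonoidAlgebra.coeff_mapRingHom]
  · rw [map_sing_coeff, ← hf, MonoidAlgebra.coeff_mapRingHom]
    rfl

theorem exists_coeff_ne_zero {w : D1 A G} (hw : w ≠ 0) :
    (∃ t, w.reg.coeff t ≠ 0) ∨ ∃ g t, (w.sing.coeff g).coeff t ≠ 0 := by
  by_contra! h
  exact hw (ext_coeff (fun t => h.1 t) fun g t => h.2 g t)

/-- A pair with `ab = 1` and `ba ≠ 1` has finitely many coefficients, hence lives over a finitely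
generated subring `R` of `k`. A nonzero coefficient of `ba - 1` stays nonzero in a finite residue
field of `R`, where stable finiteness forces it to vanish. -/
theorem isStablyFiniteRing_of_finite_fields (G : Type u) [Group G]
    (H : ∀ (k : Type v) [Field k] [Finite k], IsStablyFiniteRing (D1 k G))
    (k : Type v) [Field k] : IsStablyFiniteRing (D1 k G) := by
  refine ⟨fun n => ⟨fun {a b} hab => ?_⟩⟩
  by_contra hba
  let C : Set k := (⋃ p : Fin n × Fin n, (a p.1 p.2).coeffs) ∪ ⋃ p : Fin n × Fin n, (b p.1 p.2).coeffs
  have hC : C.Finite := (Set.finite_iUnion fun p => finite_coeffs _).union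
    (Set.finite_iUnion fun p => finite_coeffs _)
  let R := Algebra.adjoin ℤ C
  have : Algebra.FiniteType ℤ R :=
    (Subalgebra.fg_iff_finiteType R).1 ⟨hC.toFinset, by simp [R]⟩
  let φ : R →+* k := R.val.toRingHom
  have hφ : Function.Injective φ := Subtype.val_injective
  have hCr : C ⊆ Set.range φ := fun x hx => ⟨⟨x, Algebra.subset_adjoin hx⟩, rfl⟩
  have ha : ∀ i j, ∃ z, map φ z = a i j := fun i j => exists_map_eq hφ _ fun x hx =>
    hCr (Or.inl (Set.mem_iUnion.2 ⟨(i, j), hx⟩))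
  have hb : ∀ i j, ∃ z, map φ z = b i j := fun i j => exists_map_eq hφ _ fun x hx =>
    hCr (Or.inr (Set.mem_iUnion.2 ⟨(i, j), hx⟩))
  choose a' ha' using ha
  choose b' hb' using hb
  let Φ := (map (G := G) φ).mapMatrix (m := Fin n)
  have hΦ : Function.Injective Φ := fun x y h => by
    ext1 i j
    exact map_injective hφ (congrFun (congrFun h i) j)
  have ea : Φ (Matrix.of a') = a := by ext1 i j; exact ha' i j
  have eb : Φ (Matrix.of b') = b := by ext1 i j; exact hb' i j
  have h1 : Matrix.of a' * Matrix.of b' = 1 := hΦ (by rw [map_mul, ea, eb, hab, map_one])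
  have h2 : Matrix.of b' * Matrix.of a' - 1 ≠ 0 := fun h => hba (by
    rw [← ea, ← eb, ← map_mul, sub_eq_zero.1 h, map_one])
  obtain ⟨i, j, hij⟩ : ∃ i j, (Matrix.of b' * Matrix.of a' - 1) i j ≠ 0 := by
    by_contra! h
    exact h2 (by ext1 i j; exact h i j)
  have key : ∀ r : R, r ≠ 0 → ∃ (L : Type v) (_ : Field L) (_ : Finite L) (ψ : R →+* L),
      ψ r ≠ 0 := exists_finite_residueField R
  have final : ∀ (L : Type v) [Field L] [Finite L] (ψ : R →+* L),
      map ψ ((Matrix.of b' * Matrix.of a' - 1) i j) = 0 := by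
    intro L _ _ ψ
    have := H L
    let Ψ := (map (G := G) ψ).mapMatrix (m := Fin n)
    have e1 : Ψ (Matrix.of a') * Ψ (Matrix.of b') = 1 := by rw [← map_mul, h1, map_one]
    have e2 : Ψ (Matrix.of b' * Matrix.of a' - 1) = 0 := by
      rw [map_sub, map_mul, mul_eq_one_symm e1, map_one, sub_self]
    exact congrFun (congrFun e2 i) j
  rcases exists_coeff_ne_zero hij with ⟨t, ht⟩ | ⟨g, t, ht⟩
  · obtain ⟨L, _, _, ψ, hψ⟩ := key _ ht
    rw [← map_reg_coeff, final L ψ] at hψ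
    exact hψ rfl
  · obtain ⟨L, _, _, ψ, hψ⟩ := key _ ht
    rw [← map_sing_coeff, final L ψ] at hψ
    exact hψ rfl

end

end D1

/-! ### Duality for finitely supported functionals -/

theorem Finsupp.linearCombination_congr_on {R α M : Type*} [Semiring R] [AddCommMonoid M] [Module R M]
    {f f' : α → M} (y : α →₀ R) (h : ∀ a, y a ≠ 0 → f a = f' a) :
    Finsupp.linearCombination R f y = Finsupp.linearCombination R f' y := by
  rw [Finsupp.linearCombination_apply, Finsupp.linearCombination_apply]
  exact Finset.sum_congr rfl fun a ha => by
    simp only [h a (Finsupp.mem_support_iff.1 ha)]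

/-- A family of finitely supported functionals on `k^α` with trivial common kernel spans all
finitely supported functionals. -/
theorem Finsupp.exists_linearCombination_eq_single {k α β : Type*} [Field k] (r : β → α →₀ k)
    (hr : ∀ x : α → k, (∀ b, Finsupp.linearCombination k x (r b) = 0) → x = 0) (a : α) :
    ∃ y : β →₀ k, Finsupp.linearCombination k r y = Finsupp.single a 1 := by
  -- Surjectivity is tested on the dual side: a functional on `α →₀ k` is pairing with an arbitrary
  -- vector of `α → k`, so the kernel of the dual map is the common kernel of the `r b`.
  refine LinearMap.dualMap_injective_iff.1 ?_ (Finsupp.single a 1)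
  rw [← LinearMap.ker_eq_bot, LinearMap.ker_eq_bot']
  intro φ hφ
  have e : φ = Finsupp.linearCombination k fun a => φ (Finsupp.single a 1) := by
    ext b; simp
  have h0 := hr (fun a => φ (Finsupp.single a 1)) fun b => by
    have := LinearMap.congr_fun hφ (Finsupp.single b 1)
    rw [← e]
    simpa using this
  rw [e, h0]
  ext; simp

theorem Finsupp.linearCombination_curry {k ι α : Type*} [Field k] [Fintype ι]
    (F : ι × α → k) (y : ι × α →₀ k) :
    Finsupp.linearCombination k F y =
      ∑ i, Finsupp.linearCombination k (fun a => F (i, a)) (y.curry i) := by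
  classical
  induction y using Finsupp.induction_linear with
  | zero =>
    rw [map_zero]
    refine (Finset.sum_eq_zero fun i _ => ?_).symm
    have : (0 : ι × α →₀ k).curry i = 0 := by ext; simp [Finsupp.curry_apply]
    rw [this, map_zero]
  | add x y hx hy =>
    rw [map_add, hx, hy, ← Finset.sum_add_distrib]
    refine Finset.sum_congr rfl fun i _ => ?_
    rw [← map_add]
    congr 1
    ext; simp [Finsupp.curry_apply]
  | single p c =>
    obtain ⟨i, a⟩ := p
    rw [Finset.sum_eq_single i]
    · simp
    · intro j _ hj
      rw [Finsupp.curry_single, Finsupp.single_eq_of_ne hj, map_zero]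
    · simp

namespace D1

noncomputable section

variable {k G ι : Type*} [Field k] [Group G]

/-! ### Elements of `D¹(k[G])` as functions `G → k[G]` -/

/-- The element of `D¹(k[G])` with regular part `r` and evaluation `a`. -/
def ofEv (r : MonoidAlgebra k G) (a : G → MonoidAlgebra k G)
    (h : {g | a g ≠ r}.Finite) : D1 k G :=
  ⟨r, .ofCoeff (Finsupp.ofSupportFinite (fun g => a g - r)
    (h.subset fun _ hg h' => hg (sub_eq_zero.2 h')))⟩

theorem reg_ofEv (r : MonoidAlgebra k G) (a : G → MonoidAlgebra k G) (h : {g | a g ≠ r}.Finite) :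
    (ofEv r a h).reg = r := rfl

theorem ev_ofEv (r : MonoidAlgebra k G) (a : G → MonoidAlgebra k G) (h : {g | a g ≠ r}.Finite)
    (g : G) : ev (ofEv r a h) g = a g :=
  add_sub_cancel r (a g)

theorem finite_ev_ne_reg (w : D1 k G) : {g | ev w g ≠ w.reg}.Finite :=
  w.sing.coeff.hasFiniteSupport.subset fun g hg h0 => hg (by
    rw [ev, h0, add_zero])

/-- Off a finite set `ev w` equals `w.reg`, so on an infinite group the regular part can be read off
from `ev`. -/
theorem ext_of_ev [Infinite G] {w z : D1 k G} (h : ∀ g, ev w g = ev z g) : w = z := by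
  obtain ⟨g, hg⟩ := ((finite_ev_ne_reg w).union (finite_ev_ne_reg z)).infinite_compl.nonempty
  simp only [Set.mem_compl_iff, Set.mem_union, Set.mem_ofPred_eq, not_or, not_not] at hg
  exact ext_ev (by rw [← hg.1, h, hg.2]) h

/-- The finite set of all elements of `G` used by an element of `D¹(k[G])`. -/
theorem exists_finite_memory (w : D1 k G) :
    ∃ N : Set G, N.Finite ∧ (∀ t, w.reg.coeff t ≠ 0 → t ∈ N) ∧
      ∀ g t, (ev w g).coeff t ≠ 0 → t ∈ N := by
  refine ⟨Function.support w.reg.coeff ∪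
    ⋃ g ∈ {g | ev w g ≠ w.reg}, Function.support (ev w g).coeff,
    w.reg.coeff.hasFiniteSupport.union
      ((finite_ev_ne_reg w).biUnion fun g _ => (ev w g).coeff.hasFiniteSupport),
    fun t ht => Or.inl ht, fun g t ht => ?_⟩
  by_cases h : ev w g = w.reg
  · rw [h] at ht; exact Or.inl ht
  · exact Or.inr (Set.mem_biUnion (show g ∈ {g | ev w g ≠ w.reg} from h) ht)

/-- The endomorphism `(α, β) ↦ (α, 0)` of `D¹(k[G])`. -/
def constPart : D1 k G →+* D1 k G where
  toFun w := ⟨w.reg, 0⟩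
  map_one' := rfl
  map_zero' := rfl
  map_add' w z := ext_ev rfl fun g => by simp [ev, reg_add, sing_add]
  map_mul' w z := ext_ev rfl fun g => by
    have h : ∀ w : D1 k G, ev ⟨w.reg, 0⟩ = fun _ => w.reg := fun w => by
      funext x; simp [ev]
    rw [ev_mul, h z, act_const, h w, h (w * z), reg_mul]

theorem ev_constPart (w : D1 k G) (g : G) : ev (constPart w) g = w.reg :=
  add_zero w.reg

/-! ### The action on configurations -/

theorem linearCombination_single_mul (t : G) (a : k) (c : MonoidAlgebra k G) (f : G → k) :
    Finsupp.linearCombination k f (MonoidAlgebra.single t a * c).coeff =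
      a * Finsupp.linearCombination k (fun u => f (t * u)) c.coeff := by
  induction c using MonoidAlgebra.induction_linear with
  | zero => simp
  | add x y hx hy =>
    rw [mul_add, MonoidAlgebra.coeff_add, MonoidAlgebra.coeff_add, map_add, map_add, hx, hy, mul_add]
  | single u b =>
    rw [MonoidAlgebra.single_mul_single, MonoidAlgebra.coeff_single, MonoidAlgebra.coeff_single,
      Finsupp.linearCombination_single, Finsupp.linearCombination_single, smul_eq_mul, smul_eq_mul,
      mul_assoc]

/-- The twisted product is designed for this identity: it makes `toEnd` multiplicative. -/
theorem linearCombination_act (b : MonoidAlgebra k G) (F : G → MonoidAlgebra k G) (x : G → k)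
    (g : G) : Finsupp.linearCombination k (fun t => x (g * t)) (act b F g).coeff =
      Finsupp.linearCombination k
        (fun t => Finsupp.linearCombination k (fun u => x (g * t * u)) (F (g * t)).coeff)
        b.coeff := by
  induction b using MonoidAlgebra.induction_linear with
  | zero => simp [act_zero_left]
  | add y z hy hz =>
    rw [act_add_left, MonoidAlgebra.coeff_add, MonoidAlgebra.coeff_add, map_add, map_add, hy, hz]
  | single t a =>
    rw [act_single, linearCombination_single_mul]
    simp [mul_assoc]

/-- The action of `D¹(k[G])` on configurations:
`(w x)(g) = ∑ₜ ev w g (t) x(gt)`. -/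
def toEnd : D1 k G →+* Module.End k (G → k) where
  toFun w :=
    { toFun := fun x g => Finsupp.linearCombination k (fun t => x (g * t)) (ev w g).coeff
      map_add' := fun x y => by
        funext g
        simp [Finsupp.linearCombination_apply, Finsupp.sum, mul_add, Finset.sum_add_distrib]
      map_smul' := fun c x => by
        funext g
        simp [Finsupp.linearCombination_apply, Finsupp.sum, Finset.mul_sum, mul_left_comm] }
  map_one' := by
    refine LinearMap.ext fun x => funext fun g => ?_
    simp [ev_one, MonoidAlgebra.one_def]
  map_mul' w z := by
    refine LinearMap.ext fun x => funext fun g => ?_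
    simp only [LinearMap.coe_mk, AddHom.coe_mk, Module.End.mul_apply, ev_mul]
    exact linearCombination_act _ _ _ _
  map_zero' := by
    refine LinearMap.ext fun x => funext fun g => ?_
    simp [ev, reg_zero, sing_zero]
  map_add' w z := by
    refine LinearMap.ext fun x => funext fun g => ?_
    simp [ev_add]

theorem toEnd_apply (w : D1 k G) (x : G → k) (g : G) :
    toEnd w x g = Finsupp.linearCombination k (fun t => x (g * t)) (ev w g).coeff := rfl

open Classical in
theorem toEnd_single (w : D1 k G) (h g : G) :
    toEnd w (Pi.single h 1) g = (ev w g).coeff (g⁻¹ * h) := by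
  rw [toEnd_apply, Finsupp.linearCombination_apply]
  have : ∀ t : G, (Pi.single h (1 : k) : G → k) (g * t) = if t = g⁻¹ * h then 1 else 0 := by
    intro t
    rw [Pi.single_apply]
    simp only [eq_inv_mul_iff_mul_eq]
  simp only [this, smul_eq_mul, mul_ite, mul_one, mul_zero]
  simp only [Finsupp.sum, Finset.sum_ite_eq', Finsupp.mem_support_iff, ne_eq, ite_not,
    ite_eq_right_iff]
  exact fun h => h.symm

theorem toEnd_constPart (w : D1 k G) (x : G → k) (g : G) :
    toEnd (constPart w) x g =
      Finsupp.linearCombination k (fun t => x (g * t)) w.reg.coeff := by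
  rw [toEnd_apply, ev_constPart]

/-- Equivariance lets a rule found at the identity serve at every group element. -/
theorem toEnd_constPart_translate (w : D1 k G) (x : G → k) (g h : G) :
    toEnd (constPart w) (fun u => x (g * u)) h = toEnd (constPart w) x (g * h) := by
  simp only [toEnd_constPart, mul_assoc]

theorem toEnd_finite_support (w : D1 k G) {x : G → k} (hx : (Function.support x).Finite) :
    (Function.support (toEnd w x)).Finite := by
  obtain ⟨N, hN, -, hN'⟩ := exists_finite_memory w
  refine (hx.image2 (fun h t => h * t⁻¹) hN).subset fun g hg => ?_
  by_contra hcon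
  refine hg ?_
  rw [toEnd_apply, Finsupp.linearCombination_congr_on (f' := 0), Finsupp.linearCombination_zero,
    LinearMap.zero_apply]
  intro t ht
  by_contra h0
  exact hcon ⟨g * t, h0, t, hN' g t ht, by simp⟩

/-! ### Matrices acting on vector-valued configurations -/

theorem finite_ev_ne_reg_matrix [Finite ι] (W : Matrix ι ι (D1 k G)) :
    {g | ∃ i j, ev (W i j) g ≠ (W i j).reg}.Finite := by
  have : {g | ∃ i j, ev (W i j) g ≠ (W i j).reg} =
      ⋃ i, ⋃ j, {g | ev (W i j) g ≠ (W i j).reg} := by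
    ext g; simp
  rw [this]
  exact Set.finite_iUnion fun i => Set.finite_iUnion fun j => finite_ev_ne_reg _

variable [Fintype ι] [DecidableEq ι]

/-- The action of matrices over `D¹(k[G])` on configurations over `k^ι`. -/
def toOp : Matrix ι ι (D1 k G) →+* Module.End k (ι → G → k) :=
  (endVecRingEquivMatrixEnd ι k (G → k)).symm.toRingHom.comp (toEnd (k := k) (G := G)).mapMatrix

theorem toOp_apply (W : Matrix ι ι (D1 k G)) (x : ι → G → k) (i : ι) (g : G) :
    toOp W x i g = ∑ j, toEnd (W i j) (x j) g := by
  rw [← Finset.sum_apply]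
  rfl

open Classical in
theorem toOp_single (W : Matrix ι ι (D1 k G)) (j : ι) (h : G) (i : ι) (g : G) :
    toOp W (Pi.single j (Pi.single h 1)) i g = (ev (W i j) g).coeff (g⁻¹ * h) := by
  rw [toOp_apply, Finset.sum_eq_single j]
  · rw [Pi.single_eq_same, toEnd_single]
  · intro l _ hl
    rw [Pi.single_eq_of_ne hl, map_zero, Pi.zero_apply]
  · simp

open Classical in
theorem eq_of_toOp_single [Infinite G] {W Z : Matrix ι ι (D1 k G)}
    (h : ∀ (j : ι) (g : G), toOp W (Pi.single j (Pi.single g 1)) =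
      toOp Z (Pi.single j (Pi.single g 1))) : W = Z := by
  ext1 i j
  refine ext_of_ev fun g => MonoidAlgebra.coeff_injective (Finsupp.ext fun t => ?_)
  have := congrFun (congrFun (h j (g * t)) i) g
  rwa [toOp_single, toOp_single, inv_mul_cancel_left] at this

theorem toOp_injective [Infinite G] : Function.Injective (toOp (ι := ι) (k := k) (G := G)) :=
  fun W Z h => by
    classical
    exact eq_of_toOp_single fun j g => by rw [h]

theorem toOp_eq_constPart (W : Matrix ι ι (D1 k G)) (x : ι → G → k) (i : ι) (g : G)
    (h : ∀ j, ev (W i j) g = (W i j).reg) :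
    toOp W x i g = toOp (constPart.mapMatrix W) x i g := by
  rw [toOp_apply, toOp_apply]
  refine Finset.sum_congr rfl fun j _ => ?_
  rw [RingHom.mapMatrix_apply, Matrix.map_apply, toEnd_constPart, toEnd_apply, h]

theorem toOp_constPart_translate (W : Matrix ι ι (D1 k G)) (x : ι → G → k) (g : G) (i : ι) (h : G) :
    toOp (constPart.mapMatrix W) (fun j u => x j (g * u)) i h =
      toOp (constPart.mapMatrix W) x i (g * h) := by
  rw [toOp_apply, toOp_apply]
  exact Finset.sum_congr rfl fun j _ => toEnd_constPart_translate _ _ _ _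

/-! ### One-sided inverses -/

/-- The coordinates of `toOp W x` are finitely supported functionals of `x`. Injectivity says that
they have no common zero but `0`, so by duality they span all coordinate functionals. -/
theorem exists_functional (W : Matrix ι ι (D1 k G)) (hW : Function.Injective (toOp W))
    (j : ι) (g : G) : ∃ y : ι × G →₀ k, ∀ x : ι → G → k,
      Finsupp.linearCombination k (fun p => toOp W x p.1 p.2) y = x j g := by
  let r : ι × G → (ι × G →₀ k) := fun p =>
    ∑ l, (ev (W p.1 l) p.2).coeff.mapDomain fun t => (l, p.2 * t)
  have hr : ∀ (x : ι → G → k) p, Finsupp.linearCombination k (fun q => x q.1 q.2) (r p) =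
      toOp W x p.1 p.2 := by
    intro x p
    rw [map_sum, toOp_apply]
    refine Finset.sum_congr rfl fun l _ => ?_
    rw [Finsupp.linearCombination_mapDomain, toEnd_apply]
    rfl
  obtain ⟨y, hy⟩ := Finsupp.exists_linearCombination_eq_single r (fun x hx => by
    have h0 : (fun i h => x (i, h)) = 0 := hW (by
      rw [map_zero]
      funext i h
      exact (hr _ (i, h)).symm.trans (hx (i, h)))
    funext p
    exact congrFun (congrFun h0 p.1) p.2) (j, g)
  refine ⟨y, fun x => ?_⟩
  have := congrArg (Finsupp.linearCombination k fun q : ι × G => x q.1 q.2) hy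
  rw [Finsupp.linearCombination_single, one_smul] at this
  rw [← this, Finsupp.linearCombination_apply k y, Finsupp.linearCombination_apply k y,
    map_finsuppSum]
  simp only [map_smul, hr]

/-- A matrix over `D¹(k[G])` acting injectively together with its constant part is
left invertible. -/
theorem exists_left_inverse [Infinite G] (W : Matrix ι ι (D1 k G))
    (hW : Function.Injective (toOp W))
    (hW' : Function.Injective (toOp (constPart.mapMatrix W))) : ∃ Z, Z * W = 1 := by
  classical
  choose y hy using exists_functional W hW
  choose y' hy' using fun j => exists_functional _ hW' j 1
  -- The exceptional places: the rule `y' j`, translated to `g`, consults a row where `W` differs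
  -- from its constant part.
  let F : Set G := {g | ∃ j, ∃ p, y' j p ≠ 0 ∧ ∃ i l, ev (W i l) (g * p.2) ≠ (W i l).reg}
  have hF : F.Finite := by
    have : F ⊆ ⋃ j, Set.image2 (fun h (p : ι × G) => h * p.2⁻¹)
        {g | ∃ i j, ev (W i j) g ≠ (W i j).reg} (Function.support (y' j)) := by
      rintro g ⟨j, p, hp, h⟩
      exact Set.mem_iUnion.2 ⟨j, g * p.2, h, p, hp, by simp⟩
    exact (Set.finite_iUnion fun j => (finite_ev_ne_reg_matrix W).image2 _
      (y' j).hasFiniteSupport).subset this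
  let A : ι → ι → MonoidAlgebra k G := fun j i => .ofCoeff ((y' j).curry i)
  -- The functional `y j g` uses absolute positions while `ev` uses positions relative to `g`,
  -- whence the factor `g⁻¹`.
  let B : ι → ι → G → MonoidAlgebra k G := fun j i g =>
    if g ∈ F then MonoidAlgebra.single g⁻¹ 1 * .ofCoeff ((y j g).curry i) else A j i
  have hAB : ∀ j i, {g | B j i g ≠ A j i}.Finite := fun j i => hF.subset fun g hg => by
    by_contra h
    exact hg (if_neg h)
  refine ⟨Matrix.of fun j i => ofEv (A j i) (B j i) (hAB j i), toOp_injective ?_⟩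
  refine LinearMap.ext fun x => funext fun j => funext fun g => ?_
  rw [map_mul, map_one, Module.End.mul_apply, Module.End.one_apply, toOp_apply]
  simp only [toEnd_apply, Matrix.of_apply, ev_ofEv]
  by_cases hg : g ∈ F
  · simp only [B, if_pos hg, linearCombination_single_mul, mul_inv_cancel_left, one_mul]
    rw [← hy j g x, Finsupp.linearCombination_curry]
  · simp only [B, if_neg hg, A]
    rw [← Finsupp.linearCombination_curry (fun p => toOp W x p.1 (g * p.2)),
      Finsupp.linearCombination_congr_on
        (f' := fun p => toOp (constPart.mapMatrix W) (fun j u => x j (g * u)) p.1 p.2), hy', mul_one]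
    intro p hp
    rw [toOp_constPart_translate, toOp_eq_constPart]
    intro l
    by_contra h
    exact hg ⟨j, p, hp, p.1, l, h⟩

open Classical in
/-- A matrix over `D¹(k[G])` acting surjectively, together with its constant part, on finitely
supported configurations is right invertible. -/
theorem exists_right_inverse [Infinite G] (W : Matrix ι ι (D1 k G))
    (hW : ∀ (j : ι) (h : G), ∃ x : ι → G →₀ k,
      toOp W (fun i => x i) = Pi.single j (Pi.single h 1))
    (hW' : ∀ (j : ι) (h : G), ∃ x : ι → G →₀ k,
      toOp (constPart.mapMatrix W) (fun i => x i) = Pi.single j (Pi.single h 1)) :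
    ∃ Z, W * Z = 1 := by
  choose y hy using hW
  choose y' hy' using fun j => hW' j 1
  -- Here `h ∈ F` when the translate of some `y' j` to `h` meets the window of a row `g` where `W`
  -- is not constant: `g * t = h * q`. The windows of both `W` and its constant part are included,
  -- so that for `h ∉ F` both operators vanish in such rows.
  let F : Set G := ⋃ j, ⋃ i, ⋃ l, ⋃ g ∈ {g | ∃ i j, ev (W i j) g ≠ (W i j).reg},
    (Set.image2 (fun t q => g * t * q⁻¹) (Function.support (ev (W i l) g).coeff)
      (Function.support (y' j l)) ∪
    Set.image2 (fun t q => g * t * q⁻¹) (Function.support (W i l).reg.coeff)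
      (Function.support (y' j l)))
  have hF : F.Finite := by
    refine Set.finite_iUnion fun j => Set.finite_iUnion fun i => Set.finite_iUnion fun l =>
      (finite_ev_ne_reg_matrix W).biUnion fun g _ => Set.Finite.union ?_ ?_
    · exact (ev (W i l) g).coeff.hasFiniteSupport.image2 _ (y' j l).hasFiniteSupport
    · exact (W i l).reg.coeff.hasFiniteSupport.image2 _ (y' j l).hasFiniteSupport
  have hFmem : ∀ j i l g t q, (∃ i j, ev (W i j) g ≠ (W i j).reg) → y' j l q ≠ 0 →
      ((ev (W i l) g).coeff t ≠ 0 ∨ (W i l).reg.coeff t ≠ 0) → g * t * q⁻¹ ∈ F := by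
    intro j i l g t q hg hq ht
    refine Set.mem_iUnion.2 ⟨j, Set.mem_iUnion.2 ⟨i, Set.mem_iUnion.2 ⟨l,
      Set.mem_biUnion (show g ∈ {g | ∃ i j, ev (W i j) g ≠ (W i j).reg} from hg) ?_⟩⟩⟩
    exact ht.imp (fun h => ⟨t, h, q, hq, rfl⟩) fun h => ⟨t, h, q, hq, rfl⟩
  -- The columns of the right inverse: `U j h` will be a preimage of the delta configuration at `(j,
  -- h)`.
  let U : ι → G → ι → G → k := fun j h l g => if h ∈ F then y j h l g else y' j l (h⁻¹ * g)
  have hU : ∀ j h, toOp W (U j h) = Pi.single j (Pi.single h 1) := by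
    intro j h
    by_cases hh : h ∈ F
    · rw [← hy j h]
      congr 1
      funext l g
      exact if_pos hh
    · have e : U j h = fun l g => y' j l (h⁻¹ * g) := by
        funext l g
        exact if_neg hh
      have e' : toOp W (U j h) = toOp (constPart.mapMatrix W) (U j h) := by
        funext i g
        by_cases hg : ∃ i j, ev (W i j) g ≠ (W i j).reg
        · rw [toOp_apply, toOp_apply]
          refine Finset.sum_congr rfl fun l _ => ?_
          rw [RingHom.mapMatrix_apply, Matrix.map_apply, toEnd_constPart, toEnd_apply, e]
          have hz : ∀ t, ((ev (W i l) g).coeff t ≠ 0 ∨ (W i l).reg.coeff t ≠ 0) →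
              y' j l (h⁻¹ * (g * t)) = (0 : G → k) t := by
            intro t ht
            by_contra h0
            have := hFmem j i l g t _ hg h0 ht
            simp only [mul_inv_rev, inv_inv, mul_assoc] at this
            simp at this
            exact hh this
          rw [Finsupp.linearCombination_congr_on _ fun t ht => hz t (Or.inl ht),
            Finsupp.linearCombination_congr_on (W i l).reg.coeff fun t ht => hz t (Or.inr ht)]
          simp
        · push Not at hg
          exact toOp_eq_constPart _ _ _ _ (hg i)
      rw [e', e]
      funext i g
      have := congrFun (congrFun (hy' j) i) (h⁻¹ * g)
      rw [toOp_constPart_translate W (fun l => y' j l) h⁻¹ i g, this]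
      by_cases hij : i = j
      · subst hij
        simp [Pi.single_apply, inv_mul_eq_one, eq_comm]
      · simp [hij]
  -- The entry in row `g` and column `g * t` is `U j (g * t) l g`; for translated columns this is
  -- `y' j l t⁻¹`, whence the inversion.
  let A : ι → ι → MonoidAlgebra k G := fun l j => .ofCoeff ((y' j l).equivMapDomain (Equiv.inv G))
  let B : ι → ι → G → MonoidAlgebra k G := fun l j g =>
    .ofCoeff (Finsupp.ofSupportFinite (fun t => U j (g * t) l g) (by
      refine ((hF.image (g⁻¹ * ·)).union (((y' j l).hasFiniteSupport).image (·⁻¹))).subset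
        fun t ht => ?_
      by_cases hgt : g * t ∈ F
      · exact Or.inl ⟨g * t, hgt, by simp⟩
      · right
        have ht' : U j (g * t) l g ≠ 0 := ht
        simp only [U, if_neg hgt, mul_inv_rev, inv_mul_cancel_right] at ht'
        exact ⟨t⁻¹, ht', by simp⟩))
  have hAB : ∀ l j, {g | B l j g ≠ A l j}.Finite := by
    intro l j
    have hfin : (⋃ f ∈ F, (Function.support (y j f l) ∪
        (f * ·) '' Function.support (y' j l))).Finite :=
      hF.biUnion fun f _ => (y j f l).hasFiniteSupport.union ((y' j l).hasFiniteSupport.image _)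
    refine hfin.subset fun g hg => ?_
    by_contra hcon
    refine hg (MonoidAlgebra.coeff_injective (Finsupp.ext fun t => ?_))
    change U j (g * t) l g = y' j l t⁻¹
    by_cases hgt : g * t ∈ F
    · have h1 : y j (g * t) l g = 0 := by
        by_contra h0
        exact hcon (Set.mem_biUnion hgt (Or.inl h0))
      have h2 : y' j l t⁻¹ = 0 := by
        by_contra h0
        exact hcon (Set.mem_biUnion hgt (Or.inr ⟨t⁻¹, h0, by simp⟩))
      simp only [U, if_pos hgt, h1, h2]
    · simp only [U, if_neg hgt, mul_inv_rev, inv_mul_cancel_right]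
  refine ⟨Matrix.of fun l j => ofEv (A l j) (B l j) (hAB l j), eq_of_toOp_single fun j h => ?_⟩
  rw [map_mul, map_one, Module.End.mul_apply, Module.End.one_apply]
  have : toOp (Matrix.of fun l j => ofEv (A l j) (B l j) (hAB l j))
      (Pi.single j (Pi.single h 1)) = U j h := by
    funext l g
    have e := toOp_single (Matrix.of fun l j => ofEv (A l j) (B l j) (hAB l j)) j h l g
    rw [Matrix.of_apply, ev_ofEv] at e
    change _ = U j (g * (g⁻¹ * h)) l g at e
    rwa [mul_inv_cancel_left] at e
  rw [this, hU]

end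

end D1

namespace CellularAutomata

/-! ## Orbit closures of asymptotically constant configurations -/

section Orbit

variable {G S A : Type*} [Group G]

theorem mem_orbitClosure_iff {s p : G → S} :
    p ∈ orbitClosure s ↔ ∀ F : Set G, F.Finite → ∃ g, ∀ h ∈ F, shift g s h = p h := by
  let _ : TopologicalSpace S := ⊥
  have : DiscreteTopology S := ⟨rfl⟩
  change p ∈ closure (Set.range fun g : G => shift g s) ↔ _
  rw [mem_closure_iff]
  constructor
  · intro H F hF
    obtain ⟨q, hq, g, rfl⟩ := H (F.pi fun h => {p h})
      (isOpen_set_pi hF fun _ _ => isOpen_discrete _) fun h _ => rfl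
    exact ⟨g, fun h hh => hq h hh⟩
  · intro H o ho hp
    obtain ⟨I, t, ht, hI⟩ := isOpen_pi_iff.1 ho p hp
    obtain ⟨g, hg⟩ := H I I.finite_toSet
    refine ⟨shift g s, hI fun h hh => ?_, g, rfl⟩
    rw [hg h hh]
    exact (ht h hh).2

theorem shift_mem_orbitClosure (g : G) (s : G → S) : shift g s ∈ orbitClosure s :=
  mem_orbitClosure_iff.2 fun _ _ => ⟨g, fun _ _ => rfl⟩

theorem shift_one (x : G → A) : shift 1 x = x := by
  funext h; simp [shift]

theorem shift_shift (g h : G) (x : G → A) : shift g (shift h x) = shift (g * h) x := by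
  funext u; simp [shift, mul_assoc]

theorem shift_injective (g : G) : Function.Injective (shift g : (G → A) → G → A) :=
  Function.LeftInverse.injective (g := shift g⁻¹) fun x => by
    rw [shift_shift, inv_mul_cancel, shift_one]

theorem self_mem_orbitClosure (s : G → S) : s ∈ orbitClosure s := by
  have := shift_mem_orbitClosure 1 s
  rwa [shift_one] at this

variable {s : G → S} {c : S} {E : Set G}

/-- In an infinite group, a translation moves the exceptional set `E` off any finite window. -/
theorem const_mem_orbitClosure [Infinite G] (hE : E.Finite) (hs : ∀ g, g ∉ E → s g = c) :
    (fun _ => c) ∈ orbitClosure s := by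
  refine mem_orbitClosure_iff.2 fun F hF => ?_
  obtain ⟨g, hg⟩ := (hF.image2 (fun f e => f * e⁻¹) hE).infinite_compl.nonempty
  refine ⟨g, fun h hh => hs _ fun hE' => hg ⟨h, hh, g⁻¹ * h, hE', by simp⟩⟩

/-- If `p h ≠ c`, a shift by `g` agreeing with `p` at `h` has `g⁻¹ * h ∈ E`, which leaves finitely
many `g`. If `p` differed from each of these shifts, adding one point of disagreement for each to
the window would exclude them all. -/
theorem eq_shift_or_const_of_mem_orbitClosure (hE : E.Finite) (hs : ∀ g, g ∉ E → s g = c)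
    {p : G → S} (hp : p ∈ orbitClosure s) : (∃ g, p = shift g s) ∨ p = fun _ => c := by
  by_contra! hcon
  obtain ⟨h, hh⟩ := Function.ne_iff.1 hcon.2
  have hd := fun g => Function.ne_iff.1 (hcon.1 g)
  choose d hd using hd
  obtain ⟨g, hg⟩ := mem_orbitClosure_iff.1 hp (insert h (d '' ((fun e => h * e⁻¹) '' E)))
    (((hE.image _).image _).insert h)
  refine hd g (hg _ (Or.inr ⟨g, ⟨g⁻¹ * h, ?_, by simp⟩, rfl⟩)).symm
  by_contra hgE
  exact hh ((hg h (Or.inl rfl)).symm.trans (hs _ hgE))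

theorem nuca_apply (M : Set G) (s : G → (M → A) → A) (x : G → A) (g : G) :
    nuca M s x g = s g fun m => x (g * m) := by
  simp [nuca, shift]

theorem nuca_shift (M : Set G) (s : G → (M → A) → A) (g : G) (x : G → A) :
    nuca M (shift g s) x = shift g (nuca M s (shift g⁻¹ x)) := by
  funext h
  simp only [nuca_apply, shift, inv_inv]
  simp [mul_assoc]

theorem Asymptotic.shift {x y : G → A} (h : Asymptotic x y) (g : G) :
    Asymptotic (shift g x) (CellularAutomata.shift g y) := by
  obtain ⟨E, hE, hxy⟩ := h
  refine ⟨(g * ·) '' E, hE.image _, fun u hu => hxy _ fun hu' => hu ⟨_, hu', by simp⟩⟩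

/-- A shift of `s` only conjugates the map by the shift action, so injectivity needs checking for
`s` and its constant value alone. -/
theorem stablyInjective_of_injective {M : Set G} {s : G → (M → A) → A} {c : (M → A) → A}
    (hE : E.Finite) (hs : ∀ g, g ∉ E → s g = c) (h : Function.Injective (nuca M s))
    (hc : Function.Injective (nuca M fun _ => c)) : StablyInjective M s := by
  intro p hp
  rcases eq_shift_or_const_of_mem_orbitClosure hE hs hp with ⟨g, rfl⟩ | rfl
  · intro x y hxy
    rw [nuca_shift, nuca_shift] at hxy
    exact shift_injective _ (h (shift_injective _ hxy))
  · exact hc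

theorem stablyPostSurjective_of_postSurjective {M : Set G} {s : G → (M → A) → A} {c : (M → A) → A}
    (hE : E.Finite) (hs : ∀ g, g ∉ E → s g = c) (h : PostSurjective (nuca M s))
    (hc : PostSurjective (nuca M fun _ => c)) : StablyPostSurjective M s := by
  intro p hp
  rcases eq_shift_or_const_of_mem_orbitClosure hE hs hp with ⟨g, rfl⟩ | rfl
  · intro x y hxy
    have h1 := hxy.shift g⁻¹
    rw [nuca_shift, shift_shift, inv_mul_cancel, shift_one] at h1
    obtain ⟨z, hz, hzy⟩ := h _ _ h1
    refine ⟨shift g z, ?_, ?_⟩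
    · have h2 := hz.shift g
      rwa [shift_shift, mul_inv_cancel, shift_one] at h2
    · rw [nuca_shift, shift_shift, inv_mul_cancel, shift_one, hzy, shift_shift, mul_inv_cancel,
        shift_one]
  · exact hc

end Orbit

/-! ## Linear NUCA and matrices over `D¹(k[G])` -/

noncomputable section

open D1

variable {k G V ι : Type*} [Field k] [Group G] [AddCommGroup V] [Module k V]

/-- Configurations over `V` in coordinates. -/
def coordConfig (G : Type*) (e : V ≃ₗ[k] (ι → k)) : (G → V) ≃ₗ[k] (ι → G → k) where
  toFun x i g := e (x g) i
  invFun y g := e.symm fun i => y i g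
  map_add' x y := by funext i g; simp
  map_smul' c x := by funext i g; simp
  left_inv x := by funext g; simp
  right_inv y := by funext i g; simp

theorem coordConfig_apply {G : Type*} (e : V ≃ₗ[k] (ι → k)) (x : G → V) (i : ι) (g : G) :
    coordConfig G e x i g = e (x g) i := rfl

theorem Asymptotic.coord {G : Type*} {e : V ≃ₗ[k] (ι → k)} {x y : G → V} (h : Asymptotic x y) (i : ι) :
    (Function.support (coordConfig G e (x - y) i)).Finite := by
  obtain ⟨E, hE, hxy⟩ := h
  refine hE.subset fun g hg => ?_
  by_contra hgE
  refine hg ?_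
  rw [coordConfig_apply, Pi.sub_apply, hxy g hgE, sub_self, map_zero, Pi.zero_apply]

theorem asymptotic_of_coord {G : Type*} [Finite ι] {e : V ≃ₗ[k] (ι → k)} {x y : G → V}
    (h : ∀ i, (Function.support (coordConfig G e (x - y) i)).Finite) : Asymptotic x y := by
  refine ⟨_, Set.finite_iUnion h, fun g hg => sub_eq_zero.1 (e.injective (funext fun i => ?_))⟩
  by_contra hi
  refine hg (Set.mem_iUnion.2 ⟨i, fun h0 => hi ?_⟩)
  rw [map_zero, Pi.zero_apply, ← h0, coordConfig_apply, Pi.sub_apply]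

/-- The local defining map on `k^ι` with memory `M` given by a matrix over `k[G]`. -/
def localRule {G : Type*} [Fintype ι] (M : Set G) (b : Matrix ι ι (MonoidAlgebra k G)) (f : M → ι → k) : ι → k :=
  open Classical in
  -- The default `0` is immaterial once `M` contains the supports of the entries of `b`.
  fun i => ∑ j, (b i j).coeff.sum fun t a => a * if h : t ∈ M then f ⟨t, h⟩ j else 0

theorem isLinearMap_localRule {G : Type*} [Fintype ι] (M : Set G) (b : Matrix ι ι (MonoidAlgebra k G)) :
    IsLinearMap k (localRule M b) := by
  constructor
  · intro f f'
    funext i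
    simp only [localRule, Finsupp.sum, Pi.add_apply, ← Finset.sum_add_distrib, ← mul_add]
    refine Finset.sum_congr rfl fun j _ => Finset.sum_congr rfl fun t _ => ?_
    split_ifs <;> simp
  · intro c f
    funext i
    simp only [localRule, Finsupp.sum, Pi.smul_apply, smul_eq_mul, Finset.mul_sum]
    refine Finset.sum_congr rfl fun j _ => Finset.sum_congr rfl fun t _ => ?_
    split_ifs
    · ring
    · simp

theorem localRule_apply {G : Type*} [Fintype ι] {M : Set G} {b : Matrix ι ι (MonoidAlgebra k G)}
    (hb : ∀ i j t, (b i j).coeff t ≠ 0 → t ∈ M) (x : G → ι → k) (i : ι) :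
    localRule M b (fun m => x m) i =
      ∑ j, Finsupp.linearCombination k (fun t => x t j) (b i j).coeff := by
  refine Finset.sum_congr rfl fun j _ => Finset.sum_congr rfl fun t ht => ?_
  simp only [dif_pos (hb i j t (Finsupp.mem_support_iff.1 ht))]
  simp

variable [Fintype ι] [DecidableEq ι]

/-- The self-map `τ` of `V^G` is given in coordinates by the matrix `W`. -/
def IsCoordAction (e : V ≃ₗ[k] (ι → k)) (τ : (G → V) → G → V) (W : Matrix ι ι (D1 k G)) : Prop :=
  ∀ x, coordConfig G e (τ x) = toOp W (coordConfig G e x)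

namespace IsCoordAction

variable {e : V ≃ₗ[k] (ι → k)} {τ : (G → V) → G → V} {W Z : Matrix ι ι (D1 k G)}

theorem injective_iff (h : IsCoordAction e τ W) :
    Function.Injective τ ↔ Function.Injective (toOp W) := by
  rw [← (coordConfig G e).injective.of_comp_iff, ← Function.Injective.of_comp_iff' (toOp W)
    (coordConfig G e).bijective]
  have : coordConfig G e ∘ τ = toOp W ∘ coordConfig G e := funext h
  rw [this]

theorem surjective_iff (h : IsCoordAction e τ W) :
    Function.Surjective τ ↔ Function.Surjective (toOp W) := by
  rw [← (coordConfig G e).surjective.of_comp_iff (toOp W),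
    ← Function.Surjective.of_comp_iff' (coordConfig G e).bijective]
  have : coordConfig G e ∘ τ = toOp W ∘ coordConfig G e := funext h
  rw [this]

open Classical in
theorem exists_preimage_single (h : IsCoordAction e τ W) (hτ : PostSurjective τ) (j : ι) (g : G) :
    ∃ u : ι → G →₀ k, toOp W (fun i => u i) = Pi.single j (Pi.single g 1) := by
  have h0 : τ 0 = 0 := (coordConfig G e).injective (by rw [h, map_zero, map_zero])
  obtain ⟨z, hz, hzy⟩ := hτ 0 ((coordConfig G e).symm (Pi.single j (Pi.single g 1)))
    (asymptotic_of_coord (e := e) fun i => by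
      rw [h0, sub_zero, LinearEquiv.apply_symm_apply]
      refine (Set.finite_singleton g).subset fun t ht => ?_
      by_contra htg
      refine ht ?_
      by_cases hij : i = j
      · subst hij
        rw [Pi.single_eq_same, Pi.single_eq_of_ne htg]
      · rw [Pi.single_eq_of_ne hij, Pi.zero_apply])
  refine ⟨fun i => Finsupp.ofSupportFinite (coordConfig G e (z - 0) i) (hz.coord i), ?_⟩
  change toOp W (coordConfig G e (z - 0)) = _
  rw [sub_zero, ← h, hzy, LinearEquiv.apply_symm_apply]

theorem toOp_finite_support (Z : Matrix ι ι (D1 k G)) {x : ι → G → k}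
    (hx : ∀ i, (Function.support (x i)).Finite) (i : ι) :
    (Function.support (toOp Z x i)).Finite := by
  refine (Set.finite_iUnion fun j => toEnd_finite_support (Z i j) (hx j)).subset fun g hg => ?_
  by_contra hcon
  refine hg ?_
  rw [toOp_apply]
  refine Finset.sum_eq_zero fun j _ => ?_
  by_contra h0
  exact hcon (Set.mem_iUnion.2 ⟨j, h0⟩)

/-- The defect `y - τ x` is finitely supported and `Z` preserves finite support, so adding its image
under `Z` to `x` is an asymptotic correction. -/
theorem postSurjective_of_mul_eq_one (h : IsCoordAction e τ W) (hWZ : W * Z = 1) :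
    PostSurjective τ := by
  intro x y hxy
  let d := toOp Z (coordConfig G e (y - τ x))
  refine ⟨x + (coordConfig G e).symm d, asymptotic_of_coord (e := e) fun i => ?_,
    (coordConfig G e).injective ?_⟩
  · rw [add_sub_cancel_left, LinearEquiv.apply_symm_apply]
    exact toOp_finite_support Z hxy.coord i
  · rw [h, map_add, map_add, LinearEquiv.apply_symm_apply, ← Module.End.mul_apply, ← map_mul, hWZ,
      map_one, Module.End.one_apply, map_sub, h]
    abel

theorem eq_of_preInjective (h : IsCoordAction e τ W) (hτ : PreInjective τ) {x y : ι → G → k}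
    (hx : ∀ i, (Function.support (x i)).Finite) (hy : ∀ i, (Function.support (y i)).Finite)
    (hxy : toOp W x = toOp W y) : x = y := by
  refine (coordConfig G e).symm.injective (hτ _ _ (asymptotic_of_coord (e := e) fun i => ?_)
    ((coordConfig G e).injective ?_))
  · rw [← map_sub, LinearEquiv.apply_symm_apply]
    exact ((hx i).union (hy i)).subset (Function.support_sub _ _)
  · rw [h, h, LinearEquiv.apply_symm_apply, LinearEquiv.apply_symm_apply, hxy]

end IsCoordAction

theorem exists_coeffs_of_isLinearMap {G : Type*} (e : V ≃ₗ[k] (ι → k)) {M : Set G} (hM : M.Finite)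
    {f : (M → V) → V} (hf : IsLinearMap k f) :
    ∃ L : Matrix ι ι (MonoidAlgebra k G), ∀ (x : G → V) (i : ι),
      e (f fun m => x m) i =
        ∑ j, Finsupp.linearCombination k (fun t => e (x t) j) (L i j).coeff := by
  classical
  have := hM.fintype
  let ℓ : ι → (M → V) →ₗ[k] k := fun i => LinearMap.proj i ∘ₗ e.toLinearMap ∘ₗ hf.mk'
  refine ⟨fun i j => ∑ m : M, MonoidAlgebra.single (m : G)
    (ℓ i (Pi.single m (e.symm (Pi.single j 1)))), fun x i => ?_⟩
  have hx : (fun m : M => x m) =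
      ∑ j, ∑ m : M, e (x m) j • (Pi.single m (e.symm (Pi.single j 1)) : M → V) := by
    rw [Finset.sum_comm]
    funext m
    rw [Finset.sum_apply, Finset.sum_eq_single m]
    · rw [Finset.sum_apply]
      simp only [Pi.smul_apply, Pi.single_eq_same]
      refine e.injective ?_
      simp only [map_sum, map_smul, LinearEquiv.apply_symm_apply]
      exact pi_eq_sum_univ' (e (x m))
    · intro m' _ hm'
      rw [Finset.sum_apply]
      exact Finset.sum_eq_zero fun j _ => by
        rw [Pi.smul_apply, Pi.single_eq_of_ne hm'.symm, smul_zero]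
    · simp
  change ℓ i (fun m => x m) = _
  rw [hx]
  simp only [map_sum, map_smul]
  refine Finset.sum_congr rfl fun j _ => ?_
  rw [MonoidAlgebra.coeff_sum, map_sum]
  refine Finset.sum_congr rfl fun m _ => ?_
  rw [MonoidAlgebra.coeff_single, Finsupp.linearCombination_single, smul_eq_mul, smul_eq_mul,
    mul_comm]

/-- Every element of `LNUCA_c(G, V)` is given in coordinates by a matrix over `D¹(k[G])`. -/
theorem IsLNUCAc.exists_matrix [Infinite G] {M : Set G} {s : G → (M → V) → V}
    (hs : IsLNUCAc k M s) (e : V ≃ₗ[k] (ι → k)) :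
    ∃ W : Matrix ι ι (D1 k G), IsCoordAction e (nuca M s) W ∧
      ∃ p ∈ orbitClosure s, IsCoordAction e (nuca M p) (constPart.mapMatrix W) := by
  obtain ⟨E, hE, hsE⟩ := hs.asymptotically_constant
  obtain ⟨g₀, hg₀⟩ := hE.infinite_compl.nonempty
  have hc : ∀ g, g ∉ E → s g = s g₀ := fun g hg => hsE g g₀ hg hg₀
  -- The matrix is chosen as a function of the local map, not of `g`, so that equal local maps get
  -- equal matrices and the entries are constant off `E`.
  have key : ∀ f : (M → V) → V, ∃ L : Matrix ι ι (MonoidAlgebra k G), IsLinearMap k f →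
      ∀ (x : G → V) (i : ι), e (f fun m => x m) i =
        ∑ j, Finsupp.linearCombination k (fun t => e (x t) j) (L i j).coeff := by
    intro f
    by_cases hf : IsLinearMap k f
    · obtain ⟨L, hL⟩ := exists_coeffs_of_isLinearMap e hs.finite_memory hf
      exact ⟨L, fun _ => hL⟩
    · exact ⟨0, fun h => (hf h).elim⟩
  choose L hL using key
  refine ⟨Matrix.of fun i j => ofEv (L (s g₀) i j) (fun g => L (s g) i j)
    (hE.subset fun g hg => by_contra fun hgE => hg (by rw [hc g hgE])), fun x => ?_,
    fun _ => s g₀, const_mem_orbitClosure hE hc, fun x => ?_⟩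
  · funext i g
    rw [coordConfig_apply, nuca_apply, hL _ (hs.linear g) fun t => x (g * t), toOp_apply]
    simp only [toEnd_apply, Matrix.of_apply, ev_ofEv]
    rfl
  · funext i g
    rw [coordConfig_apply, nuca_apply, hL _ (hs.linear g₀) fun t => x (g * t), toOp_apply]
    simp only [RingHom.mapMatrix_apply, Matrix.map_apply, toEnd_constPart, Matrix.of_apply, reg_ofEv]
    rfl

/-- Every matrix over `D¹(k[G])` acts as an element of `LNUCA_c(G, k^ι)`. -/
theorem exists_isLNUCAc (W : Matrix ι ι (D1 k G)) :
    ∃ (M : Set G) (s : G → (M → ι → k) → ι → k) (c : (M → ι → k) → ι → k) (E : Set G),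
      IsLNUCAc k M s ∧ E.Finite ∧ (∀ g, g ∉ E → s g = c) ∧
      IsCoordAction (LinearEquiv.refl k (ι → k)) (nuca M s) W ∧
      IsCoordAction (LinearEquiv.refl k (ι → k)) (nuca M fun _ => c) (constPart.mapMatrix W) := by
  choose N hN hreg hev using fun i j => exists_finite_memory (W i j)
  let M : Set G := ⋃ i, ⋃ j, N i j
  have hNM : ∀ i j t, t ∈ N i j → t ∈ M := fun i j t ht =>
    Set.mem_iUnion.2 ⟨i, Set.mem_iUnion.2 ⟨j, ht⟩⟩
  have hconst : ∀ g, g ∉ {g | ∃ i j, ev (W i j) g ≠ (W i j).reg} →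
      localRule M (fun i j => ev (W i j) g) = localRule M fun i j => (W i j).reg := by
    intro g hg
    have : ∀ i j, ev (W i j) g = (W i j).reg := by
      intro i j
      by_contra h
      exact hg ⟨i, j, h⟩
    simp only [this]
  refine ⟨M, fun g => localRule M fun i j => ev (W i j) g, localRule M fun i j => (W i j).reg,
    _, ⟨Set.finite_iUnion fun i => Set.finite_iUnion fun j => hN i j,
      fun g => isLinearMap_localRule _ _, _, finite_ev_ne_reg_matrix W, fun g h hg hh => ?_⟩,
    finite_ev_ne_reg_matrix W, hconst, fun x => ?_, fun x => ?_⟩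
  · exact (hconst g hg).trans (hconst h hh).symm
  · funext i g
    rw [coordConfig_apply, LinearEquiv.refl_apply, nuca_apply,
      localRule_apply (fun i j t ht => hNM i j t (hev i j g t ht)) fun t => x (g * t), toOp_apply]
    rfl
  · funext i g
    rw [coordConfig_apply, LinearEquiv.refl_apply, nuca_apply,
      localRule_apply (fun i j t ht => hNM i j t (hreg i j t ht)) fun t => x (g * t), toOp_apply]
    simp only [RingHom.mapMatrix_apply, Matrix.map_apply, toEnd_constPart]
    rfl

theorem toOp_injective_of_mul_eq_one {Z W : Matrix ι ι (D1 k G)} (h : Z * W = 1) :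
    Function.Injective (toOp W) :=
  Function.LeftInverse.injective (g := toOp Z) fun x => by
    rw [← Module.End.mul_apply, ← map_mul, h, map_one, Module.End.one_apply]

theorem toOp_surjective_of_mul_eq_one {W Z : Matrix ι ι (D1 k G)} (h : W * Z = 1) :
    Function.Surjective (toOp W) :=
  Function.RightInverse.surjective (g := toOp Z) fun x => by
    rw [← Module.End.mul_apply, ← map_mul, h, map_one, Module.End.one_apply]

theorem constPart_mul_eq_one {W Z : Matrix ι ι (D1 k G)} (h : W * Z = 1) :
    constPart.mapMatrix W * constPart.mapMatrix Z = 1 := by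
  rw [← map_mul, h, map_one]

/-! ## Stable finiteness and (dual) surjunctivity -/

variable [Infinite G]

theorem surjective_of_stablyInjective [FiniteDimensional k V] [IsStablyFiniteRing (D1 k G)]
    {M : Set G} {s : G → (M → V) → V} (hs : IsLNUCAc k M s) (h : StablyInjective M s) :
    Function.Surjective (nuca M s) := by
  obtain ⟨W, hW, p, hp, hW'⟩ := hs.exists_matrix (Module.finBasis k V).equivFun
  obtain ⟨Z, hZ⟩ := exists_left_inverse W (hW.injective_iff.1 (h s (self_mem_orbitClosure s)))
    (hW'.injective_iff.1 (h p hp))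
  exact hW.surjective_iff.2 (toOp_surjective_of_mul_eq_one (mul_eq_one_symm hZ))

theorem preInjective_of_stablyPostSurjective [FiniteDimensional k V] [IsStablyFiniteRing (D1 k G)]
    {M : Set G} {s : G → (M → V) → V} (hs : IsLNUCAc k M s) (h : StablyPostSurjective M s) :
    PreInjective (nuca M s) := by
  obtain ⟨W, hW, p, hp, hW'⟩ := hs.exists_matrix (Module.finBasis k V).equivFun
  obtain ⟨Z, hZ⟩ := exists_right_inverse W
    (hW.exists_preimage_single (h s (self_mem_orbitClosure s)))
    (hW'.exists_preimage_single (h p hp))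
  exact fun x y _ hxy =>
    hW.injective_iff.2 (toOp_injective_of_mul_eq_one (mul_eq_one_symm hZ)) hxy

/-- A left inverse `Z` makes `W` stably injective, hence surjective; then `WZ` is the identity on
the image of `W`, which is everything. -/
theorem isStablyFiniteRing_of_surjective
    (H : ∀ (n : ℕ) (M : Set G) (s : G → (M → Fin n → k) → Fin n → k), IsLNUCAc k M s →
      StablyInjective M s → Function.Surjective (nuca M s)) :
    IsStablyFiniteRing (D1 k G) := by
  refine ⟨fun n => ⟨fun {Z W} hZW => ?_⟩⟩
  obtain ⟨M, s, c, E, hs, hE, hc, hW, hW'⟩ := exists_isLNUCAc W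
  have hsurj := hW.surjective_iff.1 (H n M s hs (stablyInjective_of_injective hE hc
    (hW.injective_iff.2 (toOp_injective_of_mul_eq_one hZW))
    (hW'.injective_iff.2 (toOp_injective_of_mul_eq_one (constPart_mul_eq_one hZW)))))
  refine toOp_injective (LinearMap.ext fun x => ?_)
  obtain ⟨y, rfl⟩ := hsurj x
  rw [← Module.End.mul_apply, ← map_mul, mul_assoc, hZW, mul_one, map_one, Module.End.one_apply]

/-- From `WZ = 1`, the operator of `W` agrees on a delta configuration and its image under `ZW`.
Both are finitely supported, so pre-injectivity identifies them, and delta configurations determine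
a matrix. -/
theorem isStablyFiniteRing_of_preInjective
    (H : ∀ (n : ℕ) (M : Set G) (s : G → (M → Fin n → k) → Fin n → k), IsLNUCAc k M s →
      StablyPostSurjective M s → PreInjective (nuca M s)) :
    IsStablyFiniteRing (D1 k G) := by
  classical
  refine ⟨fun n => ⟨fun {W Z} hWZ => ?_⟩⟩
  obtain ⟨M, s, c, E, hs, hE, hc, hW, hW'⟩ := exists_isLNUCAc W
  have hpre := H n M s hs (stablyPostSurjective_of_postSurjective hE hc
    (hW.postSurjective_of_mul_eq_one hWZ)
    (hW'.postSurjective_of_mul_eq_one (constPart_mul_eq_one hWZ)))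
  refine eq_of_toOp_single fun j g => ?_
  have hfin : ∀ i, (Function.support
      ((Pi.single j (Pi.single g 1) : Fin n → G → k) i)).Finite := by
    intro i
    by_cases hij : i = j
    · subst hij
      rw [Pi.single_eq_same]
      exact (Set.finite_singleton g).subset Pi.support_single_subset
    · rw [Pi.single_eq_of_ne hij]
      simp
  convert hW.eq_of_preInjective hpre (IsCoordAction.toOp_finite_support (Z * W) hfin) hfin ?_ using 1
  · rw [map_one, Module.End.one_apply]
  · rw [← Module.End.mul_apply, ← map_mul, ← mul_assoc, hWZ, one_mul]

end

end CellularAutomata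

/-! ### The equivalences -/

theorem theoremB (G : Type u) [Group G] [Infinite G] :
    List.TFAE [
      CellularAutomata.L1Surjunctive.{u, v} G,
      CellularAutomata.FinitelyL1Surjunctive.{u, v} G,
      ∀ (k : Type v) [Field k], IsStablyFiniteRing (D1 k G),
      ∀ (k : Type v) [Field k] [Finite k], IsStablyFiniteRing (D1 k G),
      CellularAutomata.DualL1Surjunctive.{u, v} G,
      CellularAutomata.FinitelyDualL1Surjunctive.{u, v} G] := by
  tfae_have 3 → 1 := fun h k V _ _ _ _ M s hs hi => by
    have := h k
    exact CellularAutomata.surjective_of_stablyInjective hs hi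
  tfae_have 1 → 2 := fun h k V _ _ _ _ M s hs hi => h k V M s hs hi
  tfae_have 2 → 4 := fun h k _ _ =>
    CellularAutomata.isStablyFiniteRing_of_surjective fun n M s hs hi => h k (Fin n → k) M s hs hi
  tfae_have 4 → 3 := fun h k _ => D1.isStablyFiniteRing_of_finite_fields G h k
  tfae_have 3 → 5 := fun h k V _ _ _ _ M s hs hi => by
    have := h k
    exact CellularAutomata.preInjective_of_stablyPostSurjective hs hi
  tfae_have 5 → 6 := fun h k V _ _ _ _ M s hs hi => h k V M s hs hi
  tfae_have 6 → 4 := fun h k _ _ =>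
    CellularAutomata.isStablyFiniteRing_of_preInjective fun n M s hs hi => h k (Fin n → k) M s hs hi
  tfae_finish
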